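/- Let $n\ge 0$ be an integer. We say that $u:\mathbb R^n\to\mathbb R$ satisfies the standing assumption (A) if $u\in C^2(\mathbb R^n)\cap L^\infty(\mathbb R^n)$, $\nabla u$ is globally Hölder continuous on $\mathbb R^n$ with some exponent $\alpha\in(0,1)$, and $|\nabla u|$ is bounded on $\mathbb R^n$. Let $P=P(s,p)$ be a function on $\mathbb R\times\mathbb R^n$ and $m:\mathbb R^n\to[0,\infty)$. We say that $P$ is a $P$-function along an entire solution $u$, with weight $m$, if $x\mapsto P(u(x),\nabla u(x))$ is $C^2$ near every point where $m>0$ and there is a linear operator $$L=-\sum_{i,j=1}^n a_{ij}(x)\,\partial_{x_i x_j}+\sum_{i=1}^n b_i(x)\,\partial_{x_i}+c(x),\qquad c\ge 0,$$ which is elliptic wherever $m>0$ and uniformly elliptic where the gradient is bounded away from zero, such that $m(x)\,L\big[P(u,\nabla u)\big](x)\le 0$ for all $x\in\mathbb R^n$. Here elliptic at $x$ means $\sum_{i,j} a_{ij}(x)\xi_i\xi_j>0$ for all $\xi\neq 0$, and uniformly elliptic where the gradient is bounded away from zero means: for every $\varepsilon>0$ there is $K$ such that at every $x$ with $|\nabla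 u(x)|\ge\varepsilon$ there is $\lambda>0$ with $\lambda|\xi|^2\le\sum_{i,j} a_{ij}(x)\xi_i\xi_j\le K\lambda|\xi|^2$ for all $\xi\in\mathbb R^n$ and $|b(x)|\le K\lambda$. **Theorem.** 1. Let $F$ be continuous and let $u$ be an entire solution of $F(u,\nabla u,\nabla^2u)=0$ in $\mathbb R^n$ that satisfies (A). Suppose that $P(u,\nabla u)=g(\nabla u)$ is a $P$-function along $u$ with weight $m(x)=\mu(|\nabla u(x)|)$, where $\mu(t)>0$ for all $t>0$, and where $g:\mathbb R^n\to[0,\infty)$ is continuous with $\{p\in\mathbb R^n: g(p)=0\}=\{0\}$. Then $u$ is constant. 2. Let $f:\mathbb R\to\mathbb R$ be differentiable and let $u$ satisfy (A) and $\Delta u=f(u)$ in $\mathbb R^n$, with $f'(u(x))\ge 0$ for all $x\in\mathbb R^n$. Then $u$ is constant. 3. Let $G:\mathbb R\to\mathbb R$ be continuous with $G(0)\neq 0$. Then there is no $u$ that satisfies (A) and $\Delta u=G(|\nabla u|^2)$ in $\mathbb R^n$. -/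

import Mathlib

open scoped NNReal Gradient Laplacian

noncomputable section

/-- `ℝⁿ` with its Euclidean norm. -/
abbrev RSpace (n : ℕ) : Type := EuclideanSpace ℝ (Fin n)

/-- The partial derivative `∂w/∂xᵢ` at `x`. -/
def partialD {n : ℕ} (i : Fin n) (w : RSpace n → ℝ) (x : RSpace n) : ℝ :=
  fderiv ℝ w x (EuclideanSpace.single i 1)

/-- The Hessian matrix `(∂²w/∂xᵢ∂xⱼ)` at `x`. -/
def hessianMatrix {n : ℕ} (w : RSpace n → ℝ) (x : RSpace n) : Matrix (Fin n) (Fin n) ℝ :=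
  Matrix.of fun i j => partialD i (partialD j w) x

/-- `u` is an entire (classical) solution of `F(u, ∇u, ∇²u) = 0`. -/
def IsEntireSolution {n : ℕ} (F : ℝ × RSpace n × Matrix (Fin n) (Fin n) ℝ → ℝ)
    (u : RSpace n → ℝ) : Prop :=
  ContDiff ℝ 2 u ∧ ∀ x, F (u x, ∇ u x, hessianMatrix u x) = 0

/-- The standing assumption on entire solutions: `u ∈ C²(ℝⁿ) ∩ L^∞(ℝⁿ)`,
`∇u ∈ C^α(ℝⁿ; ℝⁿ)` for some `α ∈ (0,1)`, and `|∇u|` is bounded. -/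
structure StandingAssumption {n : ℕ} (u : RSpace n → ℝ) : Prop where
  contDiff : ContDiff ℝ 2 u
  bounded : ∃ M : ℝ, ∀ x, |u x| ≤ M
  holder_gradient : ∃ α : ℝ≥0, 0 < α ∧ α < 1 ∧ ∃ K : ℝ≥0, HolderWith K α (∇ u)
  bounded_gradient : ∃ C : ℝ, 0 < C ∧ ∀ x, ‖∇ u x‖ ≤ C

/-- The coefficients of a second order linear operator
`L = - ∑ aᵢⱼ ∂ᵢ∂ⱼ + ∑ bᵢ ∂ᵢ + c` on `ℝⁿ`; they may depend on the point. -/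
structure LinearOperator2 (n : ℕ) where
  a : RSpace n → Matrix (Fin n) (Fin n) ℝ
  b : RSpace n → RSpace n
  c : RSpace n → ℝ

namespace LinearOperator2

variable {n : ℕ}

/-- `(L w)(x)`. -/
def apply (L : LinearOperator2 n) (w : RSpace n → ℝ) (x : RSpace n) : ℝ :=
  -(∑ i, ∑ j, L.a x i j * hessianMatrix w x i j) + (∑ i, L.b x i * partialD i w x) + L.c x * w x

/-- The quadratic form `∑ aᵢⱼ(x) ξᵢ ξⱼ` of the principal part. -/
def principalForm (L : LinearOperator2 n) (x ξ : RSpace n) : ℝ :=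
  ∑ i, ∑ j, L.a x i j * ξ i * ξ j

/-- `L` is elliptic at `x`. -/
def IsEllipticAt (L : LinearOperator2 n) (x : RSpace n) : Prop :=
  ∀ ξ : RSpace n, ξ ≠ 0 → 0 < L.principalForm x ξ

/-- `L` is uniformly elliptic on `S`, with first order coefficients controlled by the ellipticity:
with `lam` the local lower ellipticity constant, `Λ / lam` and `|b| / lam` are bounded on `S`. -/
def IsUniformlyEllipticOn (L : LinearOperator2 n) (S : Set (RSpace n)) : Prop :=
  ∃ K : ℝ, ∀ x ∈ S, ∃ lam : ℝ, 0 < lam ∧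
    (∀ ξ : RSpace n, lam * ‖ξ‖ ^ 2 ≤ L.principalForm x ξ ∧
      L.principalForm x ξ ≤ K * lam * ‖ξ‖ ^ 2) ∧
    ‖L.b x‖ ≤ K * lam

end LinearOperator2

/-- `P = P(u, ∇u)` is a `P`-function along the solution `u`, with weight `m = m(x) ≥ 0`: there is an
elliptic operator `L` with zeroth order coefficient `c ≥ 0` such that `m · L P(u, ∇u) ≤ 0` in `ℝⁿ`.
Where `m = 0` the inequality is void, so smoothness of `P(u, ∇u)` and ellipticity are asked only
where `m > 0`. Ellipticity is uniform on every set on which `|∇u|` is bounded away from `0`. -/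
def IsPFunction {n : ℕ} (u : RSpace n → ℝ) (P : ℝ → RSpace n → ℝ) (m : RSpace n → ℝ) : Prop :=
  (∀ x, 0 ≤ m x) ∧
  (∀ x, 0 < m x → ContDiffAt ℝ 2 (fun y => P (u y) (∇ u y)) x) ∧
  ∃ L : LinearOperator2 n,
    (∀ x, 0 ≤ L.c x) ∧
    (∀ x, 0 < m x → L.IsEllipticAt x) ∧
    (∀ ε : ℝ, 0 < ε → L.IsUniformlyEllipticOn {x | ε ≤ ‖∇ u x‖}) ∧
    ∀ x, m x * L.apply (fun y => P (u y) (∇ u y)) x ≤ 0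

end

/-! All three parts compare a bounded function with a small paraboloid. If `|u| ≤ M`, then `u + ε|x
- c|²` attains its minimum within distance `√(2M/ε)` of `c`, and there `|∇u|² ≤ 8Mε` and `Δu ≥ -2εn`
(`exists_isLocalMin_add_mul_norm_sub_sq`). Letting `ε → 0` gives `G(0) ≥ 0`, and the same for `-u`
and `-G` gives `G(0) ≤ 0`; this is part 3.

Parts 1 and 2 also need a strong maximum principle at infinity (`exists_forall_lt_of_tendsto_sup`):
a bounded, uniformly continuous `w` that is a subsolution wherever it exceeds some `θ < S = sup w`
stays close to `S` on balls of any prescribed radius. Translates along a maximising sequence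
converge locally uniformly to some `W ≤ S` with `W 0 = S`, and `W` must be constant. The
coefficients need not converge, so no limit equation is available; instead Hopf's barrier is added
to a late translate, and only the scale invariant ellipticity bounds enter
(`eq_of_tendsto_translates`).

Part 1: for `w = g(∇u)` with `S > 0`, this keeps `|∇u|` away from `0` on a ball large enough to
contain a penalised minimum, where `∇u` is small. Part 2: for `w = u(· + h) - u` with `S > 0`, it
makes `u` increase by at least `S/2` on each of arbitrarily many successive steps `h`, against
boundedness. -/

open Filter Topology

noncomputable section

variable {n : ℕ}

/-! ### Second order conditions at a maximum -/

/-- Second order necessary condition at a local maximum. -/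
theorem IsLocalMax.fderiv_fderiv_nonpos {E : Type*} [NormedAddCommGroup E] [NormedSpace ℝ E]
    {w : E → ℝ} {x : E} (h : IsLocalMax w x) (hw : ContDiffAt ℝ 2 w x) (ξ : E) :
    fderiv ℝ (fderiv ℝ w) x ξ ξ ≤ 0 := by
  set ℓ : ℝ → E := fun t => x + t • ξ with hℓ
  have hℓd : ∀ t, HasDerivAt ℓ ξ t := fun t => by
    simpa [hℓ] using (((hasDerivAt_id t).smul_const ξ).const_add x)
  have hℓ0 : ℓ 0 = x := by simp [hℓ]
  have hℓc : ContinuousAt ℓ 0 := (hℓd 0).continuousAt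
  have hℓt : Tendsto ℓ (𝓝 0) (𝓝 x) := by simpa [hℓ0] using hℓc.tendsto
  have hdiff : ∀ᶠ y in 𝓝 x, DifferentiableAt ℝ w y := by
    filter_upwards [hw.eventually (by simp)] with y hy
    exact hy.differentiableAt (by simp)
  have hd1 : deriv (w ∘ ℓ) =ᶠ[𝓝 0] fun t => fderiv ℝ w (ℓ t) ξ := by
    filter_upwards [hℓt.eventually hdiff] with t ht
    exact (ht.hasFDerivAt.comp_hasDerivAt t (hℓd t)).deriv
  have hd2 : HasDerivAt (deriv (w ∘ ℓ)) (fderiv ℝ (fderiv ℝ w) x ξ ξ) 0 := by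
    have hfd : DifferentiableAt ℝ (fderiv ℝ w) (ℓ 0) := by
      rw [hℓ0]
      exact (hw.fderiv_right (m := 1) (by norm_num)).differentiableAt (by simp)
    have h1 := hfd.hasFDerivAt.comp_hasDerivAt (0 : ℝ) (hℓd 0)
    have h2 := h1.clm_apply (hasDerivAt_const (0 : ℝ) ξ)
    rw [hℓ0] at h2
    refine HasDerivAt.congr_of_eventuallyEq ?_ hd1
    simpa using h2
  have hmax : IsLocalMax (w ∘ ℓ) 0 := by
    have := hℓt.eventually h
    simpa [IsLocalMax, IsMaxFilter, hℓ0] using this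
  -- A positive second derivative would make `0` a local minimum as well; the restriction to the
  -- line would then be locally constant, with zero second derivative.
  by_contra! hpos
  have hcont : ContinuousAt (w ∘ ℓ) 0 := by
    refine ContinuousAt.comp ?_ hℓc
    rw [hℓ0]; exact hw.continuousAt
  have hmin : IsLocalMin (w ∘ ℓ) 0 :=
    isLocalMin_of_deriv_deriv_pos (by rw [hd2.deriv]; exact hpos) hmax.deriv_eq_zero hcont
  have hconst : (w ∘ ℓ) =ᶠ[𝓝 0] fun _ => (w ∘ ℓ) 0 := by
    filter_upwards [hmin, hmax] with t h1 h2 using le_antisymm h2 h1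
  have h3 : deriv (w ∘ ℓ) =ᶠ[𝓝 0] fun _ => 0 := by
    simpa using hconst.deriv
  have h4 : deriv (deriv (w ∘ ℓ)) 0 = 0 := by
    rw [h3.deriv_eq]; simp
  rw [hd2.deriv] at h4
  exact hpos.ne' h4

theorem hessianMatrix_apply {w : RSpace n → ℝ} {x : RSpace n} (hw : ContDiffAt ℝ 2 w x)
    (i j : Fin n) :
    hessianMatrix w x i j =
      fderiv ℝ (fderiv ℝ w) x (EuclideanSpace.single i 1) (EuclideanSpace.single j 1) := by
  have hfd : DifferentiableAt ℝ (fderiv ℝ w) x :=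
    (hw.fderiv_right (m := 1) (by norm_num)).differentiableAt (by simp)
  have := (hfd.hasFDerivAt.clm_apply (hasFDerivAt_const (EuclideanSpace.single j (1 : ℝ)) x)).fderiv
  simp only [hessianMatrix, Matrix.of_apply]
  change fderiv ℝ (fun y => fderiv ℝ w y (EuclideanSpace.single j 1)) x _ = _
  rw [this]
  simp

theorem hessianMatrix_isSymm {w : RSpace n → ℝ} {x : RSpace n} (hw : ContDiffAt ℝ 2 w x) :
    (hessianMatrix w x).IsSymm := by
  ext i j
  rw [Matrix.transpose_apply, hessianMatrix_apply hw, hessianMatrix_apply hw]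
  exact (hw.isSymmSndFDerivAt (by simp)).eq _ _

theorem hessianMatrix_add {v w : RSpace n → ℝ} {x : RSpace n} (hv : ContDiffAt ℝ 2 v x)
    (hw : ContDiffAt ℝ 2 w x) :
    hessianMatrix (v + w) x = hessianMatrix v x + hessianMatrix w x := by
  ext i j
  rw [Matrix.add_apply, hessianMatrix_apply hv, hessianMatrix_apply hw,
    hessianMatrix_apply (show ContDiffAt ℝ 2 (v + w) x from hv.add hw)]
  have h1 : fderiv ℝ (v + w) =ᶠ[𝓝 x] fderiv ℝ v + fderiv ℝ w := by
    filter_upwards [hv.eventually (by simp), hw.eventually (by simp)] with y h1 h2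
    exact fderiv_add (h1.differentiableAt (by simp)) (h2.differentiableAt (by simp))
  rw [h1.fderiv_eq, fderiv_add
    ((hv.fderiv_right (m := 1) (by norm_num)).differentiableAt (by simp))
    ((hw.fderiv_right (m := 1) (by norm_num)).differentiableAt (by simp))]
  simp

theorem partialD_add {v w : RSpace n → ℝ} {x : RSpace n} (hv : DifferentiableAt ℝ v x)
    (hw : DifferentiableAt ℝ w x) (i : Fin n) :
    partialD i (v + w) x = partialD i v x + partialD i w x := by
  simp [partialD, fderiv_add hv hw]

theorem euclidean_eq_sum_single (ξ : RSpace n) :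
    ξ = ∑ i, ξ i • EuclideanSpace.single i (1 : ℝ) := by
  ext j
  simp [Finset.sum_apply, Pi.single_apply]

theorem IsLocalMax.sum_hessianMatrix_nonpos {w : RSpace n → ℝ} {x : RSpace n}
    (h : IsLocalMax w x) (hw : ContDiffAt ℝ 2 w x) (ξ : Fin n → ℝ) :
    ∑ i, ∑ j, ξ i * ξ j * hessianMatrix w x i j ≤ 0 := by
  have := h.fderiv_fderiv_nonpos hw (WithLp.toLp 2 ξ)
  rw [euclidean_eq_sum_single (WithLp.toLp 2 ξ)] at this
  simp only [map_sum, sum_apply, map_smul, smul_apply,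
    smul_eq_mul] at this
  refine le_trans (le_of_eq ?_) this
  simp only [Finset.mul_sum]
  rw [Finset.sum_comm]
  refine Finset.sum_congr rfl fun i _ => Finset.sum_congr rfl fun j _ => ?_
  rw [hessianMatrix_apply hw]
  ring

open scoped MatrixOrder in
/-- The trace of the product of a matrix with nonnegative quadratic form and a symmetric matrix with
nonpositive quadratic form is nonpositive. -/
theorem sum_mul_nonpos_of_quadratic_form {A N : Matrix (Fin n) (Fin n) ℝ} (hN : N.IsSymm)
    (hA : ∀ ξ : Fin n → ℝ, 0 ≤ ∑ i, ∑ j, A i j * ξ i * ξ j)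
    (hN' : ∀ ξ : Fin n → ℝ, ∑ i, ∑ j, ξ i * ξ j * N i j ≤ 0) :
    ∑ i, ∑ j, A i j * N i j ≤ 0 := by
  have hps : (-N).PosSemidef := by
    refine Matrix.PosSemidef.of_dotProduct_mulVec_nonneg ?_ fun ξ => ?_
    · ext i j
      simp [hN.apply i j]
    · have := hN' ξ
      simp only [dotProduct, Matrix.mulVec, star_trivial, Matrix.neg_apply, Finset.mul_sum]
      have h2 : ∑ i, ∑ j, ξ i * (-N i j * ξ j) = -∑ i, ∑ j, ξ i * ξ j * N i j := by
        simp only [← Finset.sum_neg_distrib]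
        refine Finset.sum_congr rfl fun i _ => Finset.sum_congr rfl fun j _ => ?_
        ring
      rw [h2]; linarith
  -- With `-N = BᵀB`, the sum is minus the total of the form of `A` over the rows of `B`. Symmetry
  -- of `A` is not needed.
  obtain ⟨B, hB⟩ : ∃ B : Matrix (Fin n) (Fin n) ℝ, -N = B.conjTranspose * B := by
    refine ⟨CFC.sqrt (-N), ?_⟩
    rw [(Matrix.nonneg_iff_posSemidef.1 (CFC.sqrt_nonneg (-N))).isHermitian.eq, CFC.sqrt_mul_sqrt_self _ hps.nonneg]
  have hNB : ∀ i j, N i j = -∑ k, B k i * B k j := fun i j => by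
    have := congrFun (congrFun hB i) j
    simp only [Matrix.neg_apply, Matrix.mul_apply, Matrix.conjTranspose_apply, star_trivial] at this
    linarith
  have h3 : ∑ i, ∑ j, A i j * N i j = -∑ k, ∑ i, ∑ j, A i j * B k i * B k j := by
    rw [Finset.sum_comm (s := Finset.univ (α := Fin n)) (f := fun k i => ∑ j, A i j * B k i * B k j),
      ← Finset.sum_neg_distrib]
    refine Finset.sum_congr rfl fun i _ => ?_
    rw [Finset.sum_comm, ← Finset.sum_neg_distrib]
    refine Finset.sum_congr rfl fun j _ => ?_
    rw [hNB, mul_neg, Finset.mul_sum]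
    simp only [mul_assoc]
  rw [h3, neg_nonpos]
  exact Finset.sum_nonneg fun k _ => hA (B k)

/-! ### The operator without zeroth order term, and the Gaussian barrier -/

/-- `∑ aᵢⱼ ∂ᵢ∂ⱼ w - ∑ bᵢ ∂ᵢ w` at `x`. -/
def pureOperator (A : Matrix (Fin n) (Fin n) ℝ) (b : RSpace n) (w : RSpace n → ℝ)
    (x : RSpace n) : ℝ :=
  (∑ i, ∑ j, A i j * hessianMatrix w x i j) - ∑ i, b i * partialD i w x

theorem pureOperator_add {A : Matrix (Fin n) (Fin n) ℝ} {b : RSpace n} {v w : RSpace n → ℝ}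
    {x : RSpace n} (hv : ContDiffAt ℝ 2 v x) (hw : ContDiffAt ℝ 2 w x) :
    pureOperator A b (v + w) x = pureOperator A b v x + pureOperator A b w x := by
  simp only [pureOperator, hessianMatrix_add hv hw, Matrix.add_apply,
    partialD_add (hv.differentiableAt (by simp)) (hw.differentiableAt (by simp)), mul_add,
    Finset.sum_add_distrib]
  ring

theorem IsLocalMax.pureOperator_nonpos {A : Matrix (Fin n) (Fin n) ℝ} {b : RSpace n}
    {w : RSpace n → ℝ} {x : RSpace n} (h : IsLocalMax w x) (hw : ContDiffAt ℝ 2 w x)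
    (hA : ∀ ξ : Fin n → ℝ, 0 ≤ ∑ i, ∑ j, A i j * ξ i * ξ j) :
    pureOperator A b w x ≤ 0 := by
  have h1 : ∀ i, partialD i w x = 0 := fun i => by
    simp [partialD, h.fderiv_eq_zero]
  simp only [pureOperator, h1, mul_zero, Finset.sum_const_zero, sub_zero]
  exact sum_mul_nonpos_of_quadratic_form (hessianMatrix_isSymm hw) hA
    (h.sum_hessianMatrix_nonpos hw)

/-- The Gaussian barrier. -/
def gaussianBarrier (κ : ℝ) (c : RSpace n) (x : RSpace n) : ℝ := Real.exp (-κ * ‖x - c‖ ^ 2)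

theorem gaussianBarrier_contDiff (κ : ℝ) (c : RSpace n) {m : WithTop ℕ∞} :
    ContDiff ℝ m (gaussianBarrier κ c) :=
  (contDiff_const.mul ((contDiff_id.sub contDiff_const).norm_sq ℝ)).exp

theorem partialD_gaussianBarrier (κ : ℝ) (c : RSpace n) (i : Fin n) (x : RSpace n) :
    partialD i (gaussianBarrier κ c) x = -2 * κ * (x i - c i) * gaussianBarrier κ c x := by
  have h1 : HasFDerivAt (fun y : RSpace n => y - c) (ContinuousLinearMap.id ℝ (RSpace n)) x :=
    (hasFDerivAt_id x).sub_const c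
  have h2 := (h1.norm_sq.const_mul (-κ)).exp
  have h3 : fderiv ℝ (gaussianBarrier κ c) x = _ := h2.fderiv
  rw [partialD, h3]
  simp [gaussianBarrier, EuclideanSpace.inner_single_right]
  ring

theorem hessianMatrix_gaussianBarrier (κ : ℝ) (c : RSpace n) (i j : Fin n) (x : RSpace n) :
    hessianMatrix (gaussianBarrier κ c) x i j =
      (4 * κ ^ 2 * ((x i - c i) * (x j - c j)) - 2 * κ * (1 : Matrix (Fin n) (Fin n) ℝ) i j) *
        gaussianBarrier κ c x := by
  have h0 : partialD j (gaussianBarrier κ c) =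
      fun x => (-2 * κ * (x j - c j)) * gaussianBarrier κ c x :=
    funext (partialD_gaussianBarrier κ c j)
  have h1 : HasFDerivAt (fun y : RSpace n => -2 * κ * (y j - c j))
      ((-2 * κ) • (EuclideanSpace.proj j : RSpace n →L[ℝ] ℝ)) x :=
    (((EuclideanSpace.proj j : RSpace n →L[ℝ] ℝ).hasFDerivAt (x := x)).sub_const (c j)).const_mul _
  have h2 : HasFDerivAt (gaussianBarrier κ c) (fderiv ℝ (gaussianBarrier κ c) x) x :=
    ((gaussianBarrier_contDiff κ c (m := 1)).differentiable (by simp) x).hasFDerivAt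
  have h3 := (h1.mul h2).fderiv
  have h4 := partialD_gaussianBarrier κ c i x
  rw [partialD] at h4
  rw [hessianMatrix, Matrix.of_apply, h0, partialD]
  erw [h3]
  simp [h4, Matrix.one_apply, eq_comm (a := j)]
  split_ifs <;> ring

/-- Scale invariant ellipticity bounds for the coefficients of `pureOperator A b`. -/
def EllipticBounds (K : ℝ) (A : Matrix (Fin n) (Fin n) ℝ) (b : RSpace n) : Prop :=
  ∃ lam : ℝ, 0 < lam ∧
    (∀ ξ : RSpace n, lam * ‖ξ‖ ^ 2 ≤ ∑ i, ∑ j, A i j * ξ i * ξ j ∧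
      ∑ i, ∑ j, A i j * ξ i * ξ j ≤ K * lam * ‖ξ‖ ^ 2) ∧
    ‖b‖ ≤ K * lam

theorem EllipticBounds.quadratic_form_nonneg {K : ℝ} {A : Matrix (Fin n) (Fin n) ℝ} {b : RSpace n}
    (h : EllipticBounds K A b) (ξ : Fin n → ℝ) : 0 ≤ ∑ i, ∑ j, A i j * ξ i * ξ j := by
  obtain ⟨lam, hlam, hA, -⟩ := h
  exact le_trans (by positivity) (hA (WithLp.toLp 2 ξ)).1

theorem pureOperator_gaussianBarrier (A : Matrix (Fin n) (Fin n) ℝ) (b : RSpace n) (κ : ℝ)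
    (c x : RSpace n) :
    pureOperator A b (gaussianBarrier κ c) x =
      (4 * κ ^ 2 * (∑ i, ∑ j, A i j * (x - c) i * (x - c) j) - 2 * κ * (∑ i, A i i) +
        2 * κ * inner ℝ b (x - c)) * gaussianBarrier κ c x := by
  have h1 : inner ℝ b (x - c) = ∑ i, b i * (x i - c i) := by
    simp [PiLp.inner_apply, mul_comm]
  have h2 : ∑ i, A i i = ∑ i, ∑ j, A i j * (1 : Matrix (Fin n) (Fin n) ℝ) i j := by
    simp [Matrix.one_apply]
  rw [h1, h2, pureOperator]
  simp only [hessianMatrix_gaussianBarrier, partialD_gaussianBarrier, Finset.mul_sum,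
    ← Finset.sum_add_distrib, ← Finset.sum_sub_distrib, Finset.sum_mul, PiLp.sub_apply, add_mul,
    sub_mul]
  refine Finset.sum_congr rfl fun i _ => ?_
  rw [sub_eq_add_neg]
  congr 1
  · refine Finset.sum_congr rfl fun j _ => ?_
    ring
  · ring

/-- The term quadratic in `κ` is at least `4κ²·lam·ρ²`, while the trace and drift terms are at least
`-2κ·K·lam·(n + s)`. The factor `lam` is common to both, so the admissible `κ` depends only on `K`,
`n`, `ρ` and `s`. -/
theorem pureOperator_gaussianBarrier_pos {K : ℝ} {A : Matrix (Fin n) (Fin n) ℝ} {b : RSpace n}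
    (h : EllipticBounds K A b) {κ ρ s : ℝ} (hκ : 0 < κ) (hρ : 0 < ρ)
    (hκK : K * (n + s) < 2 * κ * ρ ^ 2) {c x : RSpace n} (hx : ρ ≤ ‖x - c‖) (hx' : ‖x - c‖ ≤ s) :
    0 < pureOperator A b (gaussianBarrier κ c) x := by
  obtain ⟨lam, hlam, hA, hb⟩ := h
  rw [pureOperator_gaussianBarrier]
  refine mul_pos ?_ (Real.exp_pos _)
  have h1 : lam * ρ ^ 2 ≤ ∑ i, ∑ j, A i j * (x - c) i * (x - c) j :=
    le_trans (by gcongr) (hA (x - c)).1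
  have h2 : ∑ i, A i i ≤ n * (K * lam) := by
    have : ∀ i ∈ Finset.univ, A i i ≤ K * lam := fun i _ => by
      simpa [Pi.single_apply] using (hA (EuclideanSpace.single i 1)).2
    simpa using Finset.sum_le_sum this
  have h3 : -(K * lam * s) ≤ inner ℝ b (x - c) := by
    have h4 : |inner ℝ b (x - c)| ≤ ‖b‖ * ‖x - c‖ := abs_real_inner_le_norm b (x - c)
    have h5 : ‖b‖ * ‖x - c‖ ≤ K * lam * s := by
      gcongr
      exact (norm_nonneg b).trans hb
    linarith [neg_abs_le (inner ℝ b (x - c))]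
  have h6 : 0 < 2 * κ * lam * (2 * κ * ρ ^ 2 - K * (n + s)) := by
    have := sub_pos.2 hκK
    positivity
  nlinarith [mul_le_mul_of_nonneg_left h1 (by positivity : 0 ≤ 4 * κ ^ 2),
    mul_le_mul_of_nonneg_left h2 (by positivity : 0 ≤ 2 * κ),
    mul_le_mul_of_nonneg_left h3 (by positivity : 0 ≤ 2 * κ)]

theorem pureOperator_const_mul_gaussianBarrier (A : Matrix (Fin n) (Fin n) ℝ) (b : RSpace n)
    (ε κ : ℝ) (c x : RSpace n) :
    pureOperator A b (fun y => ε * gaussianBarrier κ c y) x =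
      ε * pureOperator A b (gaussianBarrier κ c) x := by
  have h1 : ∀ {w : RSpace n → ℝ} (i : Fin n), Differentiable ℝ w →
      partialD i (fun y => ε * w y) = fun y => ε * partialD i w y := fun i hw => by
    ext y
    simp [partialD, fderiv_const_mul (hw y)]
  have h2 : Differentiable ℝ (gaussianBarrier κ c) :=
    (gaussianBarrier_contDiff κ c (m := 1)).differentiable (by simp)
  have h3 : ∀ j, Differentiable ℝ (partialD j (gaussianBarrier κ c)) := fun j =>
    ((gaussianBarrier_contDiff κ c (m := 2)).fderiv_right (m := 1) (by norm_num)).differentiable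
      (by simp) |>.clm_apply (differentiable_const _)
  simp only [pureOperator, hessianMatrix, Matrix.of_apply, h1 _ h2, h1 _ (h3 _), mul_sub,
    Finset.mul_sum]
  congr 1
  · exact Finset.sum_congr rfl fun i _ => Finset.sum_congr rfl fun j _ => by ring
  · exact Finset.sum_congr rfl fun i _ => by ring

/-! ### Strong maximum principle along translates -/

/-- The closed ball with diameter the segment from `p` to `q` meets the complement of the open ball
around `p` through `q` only at `q`. -/
theorem eq_of_mem_closedBall_midpoint {p q x : RSpace n} (hpx : dist p q ≤ dist p x)
    (hx : dist x (midpoint ℝ p q) ≤ dist p q / 2) : x = q := by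
  -- The parallelogram law gives `|x - p|² + |x - q|² ≤ |p - q|²`, and `|x - p| ≥ |p - q|` leaves
  -- nothing for `|x - q|`.
  have h1 := parallelogram_law_with_norm ℝ (x - p) (x - q)
  have h2 : (x - p) + (x - q) = (2 : ℝ) • (x - midpoint ℝ p q) := by
    rw [midpoint_eq_smul_add, smul_sub, smul_smul]
    norm_num
    rw [two_smul]; abel
  have h3 : (x - p) - (x - q) = q - p := by abel
  rw [h2, h3, norm_smul] at h1
  rw [dist_comm p q, dist_comm p x, dist_eq_norm, dist_eq_norm] at hpx
  rw [dist_comm p q, dist_eq_norm, dist_eq_norm] at hx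
  norm_num at h1
  have h4 : ‖x - q‖ * ‖x - q‖ ≤ 0 := by
    nlinarith [norm_nonneg (x - q), norm_nonneg (q - p), norm_nonneg (x - p),
      norm_nonneg (x - midpoint ℝ p q)]
  have h5 : ‖x - q‖ = 0 := by nlinarith [norm_nonneg (x - q)]
  exact sub_eq_zero.1 (norm_eq_zero.1 h5)

/-- Strong maximum principle for locally uniform limits of translates of a function which is a
subsolution of an elliptic equation where it is large. -/
theorem eq_of_tendsto_translates {l : Filter ℕ} [l.NeBot] {w W : RSpace n → ℝ} {X : ℕ → RSpace n}
    {S θ K : ℝ} (hθ : θ < S)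
    (hsub : ∀ x, θ < w x → ContDiffAt ℝ 2 w x ∧
      ∃ A b, EllipticBounds K A b ∧ 0 ≤ pureOperator A b w x)
    (hW : Continuous W) (hWS : ∀ y, W y ≤ S) (hW0 : W 0 = S)
    (hlim : ∀ R η : ℝ, 0 < η → ∀ᶠ k in l, ∀ y, ‖y‖ ≤ R → |w (X k + y) - W y| < η) (p : RSpace n) :
    W p = S := by
  by_contra hp
  -- Interior ball condition: `q` is a point of `{W = S}` nearest to `p`, so the ball with diameter
  -- `pq` touches that set only at `q`.
  obtain ⟨q, hqZ, hq⟩ := (isClosed_eq hW continuous_const : IsClosed {y | W y = S}).exists_infDist_eq_dist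
    ⟨0, hW0⟩ p
  have hqmin : ∀ x, W x = S → dist p q ≤ dist p x := fun x hx =>
    hq ▸ Metric.infDist_le_dist_of_mem hx
  have hqS : W q = S := hqZ
  have hpq : 0 < dist p q := dist_pos.2 fun h => hp (h ▸ hqS)
  set c := midpoint ℝ p q with hc
  set r := dist p q / 2 with hr
  have hr0 : 0 < r := by positivity
  have hqc : dist q c = r := by
    rw [hc, dist_right_midpoint, hr]; norm_num; ring
  have hlt : ∀ x, dist x c ≤ r → x ≠ q → W x < S := fun x hx hxq =>
    (hWS x).lt_of_ne fun h => hxq (eq_of_mem_closedBall_midpoint (hqmin x h) hx)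
  obtain ⟨ρ₀, hρ₀, hρ₀W⟩ := Metric.continuousAt_iff.1 (hW.continuousAt (x := q))
    ((S - θ) / 2) (by linarith)
  -- The bound by `ρ₀ / 2` keeps `W` above `(S + θ) / 2` near `q`; the bound by `r / 2` keeps this
  -- ball at distance at least `r / 2` from the barrier's centre `c`.
  set ρ := min (ρ₀ / 2) (r / 2) with hρ
  have hρpos : 0 < ρ := by positivity
  have hρr : ρ ≤ r / 2 := min_le_right _ _
  have hWθ : ∀ x ∈ Metric.closedBall q ρ, (S + θ) / 2 < W x := fun x hx => by
    have h1 : dist x q < ρ₀ := lt_of_le_of_lt hx ((min_le_left _ _).trans_lt (by linarith))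
    have h2 := hρ₀W h1
    rw [Real.dist_eq, hqS] at h2
    linarith [(abs_lt.1 h2).1]
  -- the barrier
  obtain ⟨κ, hκ0, hκ⟩ : ∃ κ : ℝ, 0 < κ ∧ K * (n + 2 * r) < 2 * κ * (r / 2) ^ 2 := by
    refine ⟨(|K * (n + 2 * r)| + 1) / (2 * (r / 2) ^ 2), by positivity, ?_⟩
    have h2 : 2 * ((|K * (n + 2 * r)| + 1) / (2 * (r / 2) ^ 2)) * (r / 2) ^ 2 =
      |K * (n + 2 * r)| + 1 := by field_simp
    rw [h2]
    linarith [le_abs_self (K * (n + 2 * r))]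
  set h : RSpace n → ℝ := gaussianBarrier κ c with hh
  have hhc : Continuous h := (gaussianBarrier_contDiff κ c (m := 0)).continuous
  set e := h q with he
  have hge : ∀ x, e ≤ h x → dist x c ≤ r := fun x hx => by
    rw [he, hh, gaussianBarrier, gaussianBarrier, Real.exp_le_exp, ← dist_eq_norm, ← dist_eq_norm,
      hqc] at hx
    have : dist x c ^ 2 ≤ r ^ 2 := by nlinarith
    exact le_of_sq_le_sq this hr0.le
  have hh1 : ∀ x, h x ≤ 1 := fun x => by
    rw [hh, gaussianBarrier, Real.exp_le_one_iff]
    nlinarith [sq_nonneg ‖x - c‖]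
  have he0 : 0 < e := Real.exp_pos _
  have hsph : ∀ x ∈ Metric.sphere q ρ, x ≠ q := fun x hx hxq => by
    rw [hxq, Metric.mem_sphere, dist_self] at hx
    exact hρpos.ne hx
  -- a multiple of the barrier which is small on the sphere
  obtain ⟨ε, hε, hεS⟩ : ∃ ε : ℝ, 0 < ε ∧ ∀ x ∈ Metric.sphere q ρ, W x + ε * (h x - e) < S := by
    -- Where `h ≥ e` the sphere lies in the touching ball away from `q`, so `W ≤ S - σ`, and `ε = σ`
    -- suffices because `h - e < 1`. Elsewhere `h < e` and the barrier term is negative.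
    have hcpt : IsCompact (Metric.sphere q ρ ∩ {x | e ≤ h x}) :=
      (isCompact_sphere q ρ).inter_right (isClosed_le continuous_const hhc)
    obtain ⟨σ, hσ, hσW⟩ : ∃ σ : ℝ, 0 < σ ∧ ∀ x ∈ Metric.sphere q ρ ∩ {x | e ≤ h x}, W x ≤ S - σ := by
      rcases (Metric.sphere q ρ ∩ {x | e ≤ h x}).eq_empty_or_nonempty with hemp | hne
      · exact ⟨1, one_pos, by simp [hemp]⟩
      · obtain ⟨x₀, hx₀, hmax⟩ := hcpt.exists_isMaxOn hne hW.continuousOn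
        refine ⟨S - W x₀, sub_pos.2 (hlt _ (hge _ hx₀.2) (hsph _ hx₀.1)), fun x hx => ?_⟩
        have := hmax hx
        simp only [Set.mem_ofPred_eq] at this
        linarith
    refine ⟨σ, hσ, fun x hx => ?_⟩
    by_cases hxe : e ≤ h x
    · have h1 := hσW x ⟨hx, hxe⟩
      have h2 : h x - e < 1 := by linarith [hh1 x]
      nlinarith
    · have h1 := hWS x
      push Not at hxe
      nlinarith
  obtain ⟨τ, hτ, hτS⟩ : ∃ τ : ℝ, 0 < τ ∧
      ∀ x ∈ Metric.sphere q ρ, W x + ε * (h x - e) ≤ S - τ := by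
    rcases (Metric.sphere q ρ).eq_empty_or_nonempty with hemp | hne
    · exact ⟨1, one_pos, by simp [hemp]⟩
    · obtain ⟨x₀, hx₀, hmax⟩ := (isCompact_sphere q ρ).exists_isMaxOn hne
        (f := fun x => W x + ε * (h x - e)) (by fun_prop)
      refine ⟨S - (W x₀ + ε * (h x₀ - e)), sub_pos.2 (hεS x₀ hx₀), fun x hx => ?_⟩
      have := hmax hx
      simp only [Set.mem_ofPred_eq] at this
      linarith
  -- An error below `τ / 2` keeps the perturbed translate at `q` above its values on the sphere,
  -- which lie lower by `τ` in the limit. An error below `(S - θ) / 2` keeps `w` above `θ` on the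
  -- ball.
  obtain ⟨k, hk⟩ := (hlim (‖q‖ + ρ) (min (τ / 2) ((S - θ) / 2))
    (lt_min (by positivity) (by linarith))).exists
  have hkq : ∀ x ∈ Metric.closedBall q ρ,
      |w (X k + x) - W x| < τ / 2 ∧ |w (X k + x) - W x| < (S - θ) / 2 := fun x hx => by
    have h1 : ‖x‖ ≤ ‖q‖ + ρ := by
      have h2 : ‖x - q‖ ≤ ρ := by rw [← dist_eq_norm]; exact hx
      linarith [norm_le_norm_add_norm_sub' x q]
    exact lt_min_iff.1 (hk x h1)
  have hwθ : ∀ x ∈ Metric.closedBall q ρ, θ < w (X k + x) := fun x hx => by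
    linarith [(abs_lt.1 (hkq x hx).2).1, hWθ x hx]
  -- the perturbed function has an interior maximum
  set v : RSpace n → ℝ := fun x => w x + ε * gaussianBarrier κ (X k + c) x with hv
  have hhX : ∀ x, gaussianBarrier κ (X k + c) (X k + x) = h x := fun x => by
    simp [hh, gaussianBarrier]
  have hcontv : ContinuousOn (fun x => v (X k + x)) (Metric.closedBall q ρ) := fun x hx => by
    refine ContinuousAt.continuousWithinAt ?_
    have h1 : ContinuousAt w (X k + x) := (hsub _ (hwθ x hx)).1.continuousAt
    have h2 : ContinuousAt (fun x => w (X k + x)) x :=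
      ContinuousAt.comp (f := fun x => X k + x) h1 (by fun_prop)
    simp only [hv, hhX]
    exact h2.add (by fun_prop)
  obtain ⟨z, hz, hzmax⟩ := (isCompact_closedBall q ρ).exists_isMaxOn
    ⟨q, Metric.mem_closedBall_self hρpos.le⟩ hcontv
  have hzq : v (X k + q) ≤ v (X k + z) := hzmax (Metric.mem_closedBall_self hρpos.le)
  have hzball : z ∈ Metric.ball q ρ := by
    by_contra hzb
    have hzs : z ∈ Metric.sphere q ρ := by
      rw [Metric.mem_sphere]
      rw [Metric.mem_ball, not_lt] at hzb
      exact le_antisymm hz hzb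
    have h1 := hτS z hzs
    simp only [hv, hhX] at hzq
    have h2 := (abs_lt.1 (hkq z hz).1).2
    have h3 := (abs_lt.1 (hkq q (Metric.mem_closedBall_self hρpos.le)).1).1
    rw [hqS] at h3
    nlinarith
  have hloc : IsLocalMax v (X k + z) := by
    have h1 : ∀ᶠ y in 𝓝 (X k + z), y - X k ∈ Metric.ball q ρ := by
      refine ContinuousAt.eventually_mem (f := fun y => y - X k) (by fun_prop) ?_
      simpa using Metric.isOpen_ball.mem_nhds hzball
    filter_upwards [h1] with y hy
    have := hzmax (Metric.ball_subset_closedBall hy)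
    simpa using this
  obtain ⟨hwC, A, b, hAb, hLw⟩ := hsub _ (hwθ z hz)
  have hbarC : ContDiffAt ℝ 2 (gaussianBarrier κ (X k + c)) (X k + z) :=
    (gaussianBarrier_contDiff κ _).contDiffAt
  have hbarC' : ContDiffAt ℝ 2 (fun x => ε * gaussianBarrier κ (X k + c) x) (X k + z) :=
    contDiffAt_const.mul hbarC
  have hvC : ContDiffAt ℝ 2 v (X k + z) := hwC.add hbarC'
  have hle := hloc.pureOperator_nonpos hvC hAb.quadratic_form_nonneg (b := b)
  have hadd : pureOperator A b v (X k + z) = _ := pureOperator_add hwC hbarC'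
  -- At the maximum the operator is nonpositive on the sum, yet it is nonnegative on `w` and
  -- positive on the barrier.
  rw [hadd, pureOperator_const_mul_gaussianBarrier] at hle
  have hzc : X k + z - (X k + c) = z - c := by abel
  have hzq' : dist z q ≤ r / 2 := hρr.trans' hz
  have hpos := pureOperator_gaussianBarrier_pos hAb hκ0 (half_pos hr0) hκ
    (c := X k + c) (x := X k + z)
    (by rw [hzc, ← dist_eq_norm]; linarith [dist_triangle_left q c z])
    (by rw [hzc, ← dist_eq_norm]; linarith [dist_triangle z q c])
  linarith [mul_pos hε hpos]

/-- A bounded uniformly continuous subsolution almost attains its supremum on arbitrarily large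
balls. -/
theorem exists_forall_lt_of_tendsto_sup {w : RSpace n → ℝ} {X : ℕ → RSpace n} {C S θ K : ℝ}
    (hw : UniformContinuous w) (hC : ∀ x, |w x| ≤ C) (hS : ∀ x, w x ≤ S)
    (hX : Tendsto (fun k => w (X k)) atTop (𝓝 S)) (hθ : θ < S)
    (hsub : ∀ x, θ < w x → ContDiffAt ℝ 2 w x ∧
      ∃ A b, EllipticBounds K A b ∧ 0 ≤ pureOperator A b w x) (R η : ℝ) (hη : 0 < η) :
    ∃ k, ∀ y, ‖y‖ ≤ R → S - η < w (X k + y) := by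
  -- Along an ultrafilter the bounded values converge at every `y` at once, which replaces a
  -- diagonal extraction. The common modulus of continuity makes the convergence uniform on balls.
  let l : Ultrafilter ℕ := hyperfilter ℕ
  have hl : (l : Filter ℕ) ≤ atTop := Nat.hyperfilter_le_atTop
  have hex : ∀ y, ∃ a, Tendsto (fun k => w (X k + y)) l (𝓝 a) := fun y => by
    obtain ⟨a, -, ha⟩ := (isCompact_Icc (a := -C) (b := C)).ultrafilter_le_nhds
      (l.map fun k => w (X k + y)) (le_principal_iff.2 (Ultrafilter.mem_coe.2
        (Ultrafilter.mem_map.2 (univ_mem' fun k => abs_le.1 (hC _)))))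
    exact ⟨a, ha⟩
  choose W hWlim using hex
  have hmod : ∀ η : ℝ, 0 < η → ∃ δ : ℝ, 0 < δ ∧ ∀ y z : RSpace n, dist y z < δ →
      (∀ k, |w (X k + y) - w (X k + z)| < η) ∧ |W y - W z| ≤ η := fun η hη => by
    obtain ⟨δ, hδ, h⟩ := Metric.uniformContinuous_iff.1 hw η hη
    refine ⟨δ, hδ, fun y z hyz => ?_⟩
    have h1 : ∀ k, |w (X k + y) - w (X k + z)| < η := fun k => h (by simpa using hyz)
    exact ⟨h1, le_of_tendsto ((hWlim y).sub (hWlim z)).abs (Eventually.of_forall fun k => (h1 k).le)⟩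
  have hWc : Continuous W := by
    refine Metric.continuous_iff.2 fun y η hη => ?_
    obtain ⟨δ, hδ, h⟩ := hmod (η / 2) (by positivity)
    exact ⟨δ, hδ, fun z hz => ((h z y hz).2).trans_lt (by linarith)⟩
  have hlim : ∀ R η : ℝ, 0 < η → ∀ᶠ k in (l : Filter ℕ), ∀ y, ‖y‖ ≤ R →
      |w (X k + y) - W y| < η := fun R η hη => by
    obtain ⟨δ, hδ, h⟩ := hmod (η / 3) (by positivity)
    obtain ⟨t, -, htf, ht⟩ := (isCompact_closedBall (0 : RSpace n) R).finite_cover_balls hδ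
    have h1 : ∀ᶠ k in (l : Filter ℕ), ∀ z ∈ t, |w (X k + z) - W z| < η / 3 :=
      (eventually_all_finite htf).2 fun z _ =>
        Metric.tendsto_nhds.1 (hWlim z) (η / 3) (by positivity)
    filter_upwards [h1] with k hk y hy
    obtain ⟨z, hz, hyz⟩ := Set.mem_iUnion₂.1 (ht (by simpa using hy : y ∈ Metric.closedBall 0 R))
    have h2 := abs_lt.1 (hk z hz)
    have h3 := abs_lt.1 ((h y z hyz).1 k)
    have h4 := abs_le.1 (h y z hyz).2
    exact abs_lt.2 ⟨by linarith, by linarith⟩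
  have hW0 : W 0 = S := by
    refine tendsto_nhds_unique (hWlim 0) ?_
    simpa using hX.mono_left hl
  have hWS : ∀ y, W y ≤ S := fun y =>
    le_of_tendsto (hWlim y) (Eventually.of_forall fun k => hS _)
  have hWall := eq_of_tendsto_translates hθ hsub hWc hWS hW0 hlim
  obtain ⟨k, hk⟩ := (hlim R η hη).exists
  refine ⟨k, fun y hy => ?_⟩
  have := abs_lt.1 (hk y hy)
  rw [hWall y] at this
  linarith

/-! ### The Laplacian in coordinates -/

theorem laplacian_eq_sum_hessianMatrix {w : RSpace n → ℝ} {x : RSpace n}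
    (hw : ContDiffAt ℝ 2 w x) : Δ w x = ∑ i, hessianMatrix w x i i := by
  rw [InnerProductSpace.laplacian_eq_iteratedFDeriv_orthonormalBasis w
    (EuclideanSpace.basisFun (Fin n) ℝ)]
  refine Finset.sum_congr rfl fun i _ => ?_
  rw [hessianMatrix_apply hw, iteratedFDeriv_two_apply]
  simp

theorem pureOperator_one_zero {w : RSpace n → ℝ} {x : RSpace n} (hw : ContDiffAt ℝ 2 w x) :
    pureOperator 1 0 w x = Δ w x := by
  simp [pureOperator, laplacian_eq_sum_hessianMatrix hw, Matrix.one_apply]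

theorem ellipticBounds_one_zero : EllipticBounds 1 (1 : Matrix (Fin n) (Fin n) ℝ) 0 := by
  refine ⟨1, one_pos, fun ξ => ?_, by simp⟩
  have : ∑ i, ∑ j, (1 : Matrix (Fin n) (Fin n) ℝ) i j * ξ i * ξ j = ‖ξ‖ ^ 2 := by
    simp [EuclideanSpace.norm_sq_eq, Matrix.one_apply, ← pow_two]
  rw [this]
  simp

theorem IsLocalMax.laplacian_nonpos {w : RSpace n → ℝ} {x : RSpace n} (h : IsLocalMax w x)
    (hw : ContDiffAt ℝ 2 w x) : Δ w x ≤ 0 := by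
  rw [← pureOperator_one_zero hw]
  exact h.pureOperator_nonpos hw ellipticBounds_one_zero.quadratic_form_nonneg

theorem hasFDerivAt_mul_norm_sub_sq (ε : ℝ) (c x : RSpace n) :
    HasFDerivAt (fun y : RSpace n => ε * ‖y - c‖ ^ 2) ((2 * ε) • innerSL ℝ (x - c)) x := by
  have h1 : HasFDerivAt (fun y : RSpace n => y - c) (ContinuousLinearMap.id ℝ (RSpace n)) x :=
    (hasFDerivAt_id x).sub_const c
  refine (h1.norm_sq.const_mul ε).congr_fderiv ?_
  ext y
  simp only [smul_apply, ContinuousLinearMap.comp_apply, ContinuousLinearMap.id_apply,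
    innerSL_apply_apply, smul_eq_mul, nsmul_eq_mul]
  push_cast
  ring

theorem laplacian_mul_norm_sub_sq (ε : ℝ) (c x : RSpace n) :
    Δ (fun y : RSpace n => ε * ‖y - c‖ ^ 2) x = 2 * ε * n := by
  have hC : ContDiff ℝ 2 (fun y : RSpace n => ε * ‖y - c‖ ^ 2) :=
    contDiff_const.mul ((contDiff_id.sub contDiff_const).norm_sq ℝ)
  have h1 : fderiv ℝ (fun y : RSpace n => ε * ‖y - c‖ ^ 2) =
      fun y => (2 * ε) • innerSL ℝ (y - c) :=
    funext fun y => (hasFDerivAt_mul_norm_sub_sq ε c y).fderiv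
  have h2 : HasFDerivAt (fun y : RSpace n => (2 * ε) • innerSL ℝ (y - c))
      ((2 * ε) • innerSL ℝ) x := by
    have h3 : HasFDerivAt (fun y : RSpace n => y - c) (ContinuousLinearMap.id ℝ (RSpace n)) x :=
      (hasFDerivAt_id x).sub_const c
    exact ((innerSL ℝ (E := RSpace n)).hasFDerivAt.comp x h3).const_smul (2 * ε)
  rw [laplacian_eq_sum_hessianMatrix hC.contDiffAt]
  simp only [hessianMatrix_apply hC.contDiffAt, h1, h2.fderiv, smul_apply]
  have h3 : ∀ i : Fin n, innerSL ℝ (EuclideanSpace.single i (1 : ℝ)) (EuclideanSpace.single i 1) =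
      (1 : ℝ) := fun i => by
    rw [innerSL_apply_apply, real_inner_self_eq_norm_sq]
    simp
  simp only [h3]
  simp [mul_comm]

/-! ### Penalised minima and part 3 -/

/-- Penalisation: a bounded function plus a small paraboloid attains its minimum at a point where
the function has small gradient. -/
theorem exists_isLocalMin_add_mul_norm_sub_sq {u : RSpace n → ℝ} (hu : ContDiff ℝ 2 u) {M : ℝ}
    (hM : ∀ x, |u x| ≤ M) (c : RSpace n) {ε : ℝ} (hε : 0 < ε) :
    ∃ x, ε * ‖x - c‖ ^ 2 ≤ 2 * M ∧ ‖∇ u x‖ ^ 2 ≤ 8 * M * ε ∧ -(2 * ε * n) ≤ Δ u x := by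
  have hM0 : 0 ≤ M := (abs_nonneg _).trans (hM 0)
  set q : RSpace n → ℝ := fun y => ε * ‖y - c‖ ^ 2 with hq
  have hqC : ContDiff ℝ 2 q := contDiff_const.mul ((contDiff_id.sub contDiff_const).norm_sq ℝ)
  -- Farther than `√(2M/ε)` from `c` the penalty exceeds `2M`, the largest possible oscillation of
  -- `u`, so the value at `c` is not beaten there.
  obtain ⟨x, hx⟩ := (hu.continuous.add hqC.continuous).exists_forall_le' c (by
    filter_upwards [(isCompact_closedBall c (√(2 * M / ε))).compl_mem_cocompact] with y hy
    rw [Set.mem_compl_iff, Metric.mem_closedBall, not_le, dist_eq_norm] at hy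
    have h1 : 2 * M / ε < ‖y - c‖ ^ 2 := (Real.sqrt_lt' ((Real.sqrt_nonneg _).trans_lt hy)).1 hy
    rw [div_lt_iff₀ hε] at h1
    have h2 := abs_le.1 (hM y)
    have h3 := abs_le.1 (hM c)
    simp only [Pi.add_apply, hq, sub_self, norm_zero]
    linarith)
  have hmin : IsLocalMin (u + q) x := Eventually.of_forall hx
  have hxc : ε * ‖x - c‖ ^ 2 ≤ 2 * M := by
    have h1 := hx c
    have h2 := abs_le.1 (hM x)
    have h3 := abs_le.1 (hM c)
    simp only [Pi.add_apply, hq, sub_self, norm_zero] at h1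
    linarith
  refine ⟨x, hxc, ?_, ?_⟩
  · have hd := hmin.hasFDerivAt_eq_zero
      ((hu.differentiable (by simp) x).hasFDerivAt.add (hasFDerivAt_mul_norm_sub_sq ε c x))
    have h1 : ∇ u x = -((2 * ε) • (x - c)) := by
      refine ext_inner_right ℝ fun y => ?_
      have h2 := congrArg (fun T : RSpace n →L[ℝ] ℝ => T y) hd
      simp only [add_apply, smul_apply, innerSL_apply_apply, zero_apply, smul_eq_mul] at h2
      rw [inner_gradient_left, inner_neg_left, real_inner_smul_left]
      linarith
    -- Since `∇u = -2ε(x - c)`, its squared norm is `4ε · ε|x - c|² ≤ 4ε · 2M`.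
    rw [h1, norm_neg, norm_smul, Real.norm_of_nonneg (by positivity)]
    nlinarith [mul_le_mul_of_nonneg_left hxc hε.le]
  · have h1 : Δ (-(u + q)) x ≤ 0 := hmin.neg.laplacian_nonpos (hu.add hqC).neg.contDiffAt
    rw [InnerProductSpace.laplacian_neg, Pi.neg_apply,
      hu.contDiffAt.laplacian_add hqC.contDiffAt, laplacian_mul_norm_sub_sq] at h1
    linarith

/-- If `G(0) < 0`, then `G < G(0)/2` near `0`; but at a penalised minimum with small `ε` the
argument of `G` is near `0` while `Δu ≥ -2εn > G(0)/2`. -/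
theorem nonneg_of_laplacian_eq_comp_gradient {G : ℝ → ℝ} (hG : ContinuousAt G 0)
    {u : RSpace n → ℝ} (hu : ContDiff ℝ 2 u) {M : ℝ} (hM : ∀ x, |u x| ≤ M)
    (h : ∀ x, Δ u x = G (‖∇ u x‖ ^ 2)) : 0 ≤ G 0 := by
  by_contra! hneg
  have hM0 : 0 ≤ M := (abs_nonneg _).trans (hM 0)
  obtain ⟨δ, hδ, hGδ⟩ := Metric.continuousAt_iff.1 hG (-G 0 / 2) (by linarith)
  have h1 : ∀ᶠ ε in 𝓝[>] (0 : ℝ), 8 * M * ε < δ := by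
    refine Filter.Eventually.filter_mono nhdsWithin_le_nhds ?_
    exact (show Continuous fun ε : ℝ => 8 * M * ε by fun_prop).continuousAt.eventually_lt
      continuousAt_const (by simpa using hδ)
  have h2 : ∀ᶠ ε in 𝓝[>] (0 : ℝ), 2 * ε * n < -G 0 / 2 := by
    refine Filter.Eventually.filter_mono nhdsWithin_le_nhds ?_
    exact (show Continuous fun ε : ℝ => 2 * ε * n by fun_prop).continuousAt.eventually_lt
      continuousAt_const (by simpa using hneg)
  obtain ⟨ε, hε1, hε2, hε⟩ := (h1.and (h2.and self_mem_nhdsWithin)).exists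
  obtain ⟨x, -, hx1, hx2⟩ := exists_isLocalMin_add_mul_norm_sub_sq hu hM 0 hε
  rw [h] at hx2
  have h3 := hGδ (x := ‖∇ u x‖ ^ 2) (by
    rw [Real.dist_eq, sub_zero, abs_of_nonneg (by positivity)]; linarith)
  rw [Real.dist_eq] at h3
  linarith [(abs_lt.1 h3).2]

theorem gradient_neg_apply (u : RSpace n → ℝ) (x : RSpace n) : ∇ (-u) x = -∇ u x := by
  refine ext_inner_right ℝ fun y => ?_
  rw [inner_gradient_left, inner_neg_left, inner_gradient_left, fderiv_neg]
  simp

theorem not_exists_laplacian_eq_comp_gradient {G : ℝ → ℝ} (hG : Continuous G) (hG0 : G 0 ≠ 0) :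
    ¬ ∃ u : RSpace n → ℝ, StandingAssumption u ∧ ∀ x, Δ u x = G (‖∇ u x‖ ^ 2) := by
  rintro ⟨u, hu, h⟩
  obtain ⟨M, hM⟩ := hu.bounded
  have h1 := nonneg_of_laplacian_eq_comp_gradient hG.continuousAt hu.contDiff hM h
  have h2 := nonneg_of_laplacian_eq_comp_gradient (G := -G) hG.neg.continuousAt (u := -u)
    hu.contDiff.neg (M := M) (by simpa using hM) (fun x => by
      rw [InnerProductSpace.laplacian_neg, gradient_neg_apply, norm_neg, Pi.neg_apply, h x,
        Pi.neg_apply])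
  rw [Pi.neg_apply] at h2
  exact hG0 (by linarith)

/-! ### Part 1: `P`-functions of the gradient -/

theorem exists_eq_const_of_gradient_eq_zero {u : RSpace n → ℝ} (hu : Differentiable ℝ u)
    (h : ∀ x, ∇ u x = 0) : ∃ k : ℝ, ∀ x, u x = k := by
  refine ⟨u 0, fun x => is_const_of_fderiv_eq_zero hu (fun y => ?_) x 0⟩
  ext v
  rw [← inner_gradient_left, h]
  simp

theorem exists_eq_const_of_isPFunction {u : RSpace n → ℝ} {g : RSpace n → ℝ} {μ : ℝ → ℝ}
    (hu : StandingAssumption u) (hg : Continuous g) (hg0 : ∀ p, 0 ≤ g p)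
    (hgz : {p | g p = 0} = {0}) (hμ : ∀ t : ℝ, 0 < t → 0 < μ t)
    (hP : IsPFunction u (fun _ p => g p) (fun x => μ ‖∇ u x‖)) : ∃ k : ℝ, ∀ x, u x = k := by
  obtain ⟨M, hM⟩ := hu.bounded
  obtain ⟨α, hα, -, Kα, hHolder⟩ := hu.holder_gradient
  obtain ⟨B, hB, hgrad⟩ := hu.bounded_gradient
  obtain ⟨-, hsm, L, hc, -, hunif, hL⟩ := hP
  have hM0 : 0 ≤ M := (abs_nonneg _).trans (hM 0)
  have hgzero : ∀ p, g p = 0 → p = 0 := fun p hp => by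
    have : p ∈ {p | g p = 0} := hp
    rwa [hgz] at this
  have hg00 : g 0 = 0 := by
    have : (0 : RSpace n) ∈ {p | g p = 0} := by rw [hgz]; rfl
    exact this
  set w : RSpace n → ℝ := fun x => g (∇ u x) with hw
  by_contra hne
  obtain ⟨x₀, hx₀⟩ : ∃ x, ∇ u x ≠ 0 := by
    by_contra! h
    exact hne (exists_eq_const_of_gradient_eq_zero (hu.contDiff.differentiable (by simp)) h)
  have hcpt := isCompact_closedBall (0 : RSpace n) B
  have hmem : ∀ x, ∇ u x ∈ Metric.closedBall (0 : RSpace n) B := fun x => by simpa using hgrad x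
  obtain ⟨C, hC⟩ := hcpt.exists_bound_of_continuousOn hg.continuousOn
  have hwC : ∀ x, |w x| ≤ C := fun x => hC _ (hmem x)
  have hwu : UniformContinuous w := by
    have h1 := hcpt.uniformContinuousOn_of_continuous hg.continuousOn
    have h2 := hHolder.uniformContinuous hα
    rw [Metric.uniformContinuous_iff]
    intro η hη
    obtain ⟨δ, hδ, h3⟩ := Metric.uniformContinuousOn_iff.1 h1 η hη
    obtain ⟨δ', hδ', h4⟩ := Metric.uniformContinuous_iff.1 h2 δ hδ
    exact ⟨δ', hδ', fun _ _ hab => h3 _ (hmem _) _ (hmem _) (h4 hab)⟩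
  have hbdd : BddAbove (Set.range w) := ⟨C, by rintro _ ⟨x, rfl⟩; exact (abs_le.1 (hwC x)).2⟩
  set S := sSup (Set.range w) with hS
  have hwS : ∀ x, w x ≤ S := fun x => le_csSup hbdd ⟨x, rfl⟩
  have hS0 : 0 < S := lt_of_lt_of_le
    ((hg0 _).lt_of_ne fun h => hx₀ (hgzero _ h.symm)) (hwS x₀)
  obtain ⟨s, -, hsS, hsr⟩ := exists_seq_tendsto_sSup (Set.range_nonempty w) hbdd
  choose X hXs using hsr
  have hXS : Tendsto (fun k => w (X k)) atTop (𝓝 S) := by simpa only [hXs] using hsS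
  -- Since `g` vanishes at `0`, the set `{w > S/2}` lies in `{|∇u| ≥ ε₀}`, where the ellipticity is
  -- uniform.
  obtain ⟨ε₀, hε₀, hgε⟩ := Metric.continuousAt_iff.1 (hg.continuousAt (x := 0)) (S / 2)
    (by positivity)
  have hsmall : ∀ p, ‖p‖ < ε₀ → g p < S / 2 := fun p hp => by
    have := hgε (x := p) (by simpa using hp)
    rw [hg00, Real.dist_eq, sub_zero] at this
    exact (le_abs_self _).trans_lt this
  obtain ⟨K, hK⟩ := hunif ε₀ hε₀
  have hsub : ∀ x, S / 2 < w x → ContDiffAt ℝ 2 w x ∧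
      ∃ A b, EllipticBounds K A b ∧ 0 ≤ pureOperator A b w x := fun x hx => by
    have hx1 : ε₀ ≤ ‖∇ u x‖ := by
      by_contra! h
      exact lt_asymm hx (hsmall _ h)
    have hm : 0 < μ ‖∇ u x‖ := hμ _ (hε₀.trans_le hx1)
    refine ⟨hsm x hm, L.a x, L.b x, hK x hx1, ?_⟩
    have h1 : L.apply w x ≤ 0 := nonpos_of_mul_nonpos_right (hL x) hm
    -- The zeroth order term has a favourable sign because `c ≥ 0` and `g ≥ 0`, so it can be
    -- dropped.
    have h2 : 0 ≤ L.c x * w x := mul_nonneg (hc x) (hg0 _)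
    rw [LinearOperator2.apply] at h1
    rw [pureOperator]
    linarith
  obtain ⟨ε, hε, hεε⟩ : ∃ ε : ℝ, 0 < ε ∧ 8 * M * ε < ε₀ ^ 2 := by
    -- The summand `1` covers the case `M = 0`.
    refine ⟨ε₀ ^ 2 / (8 * M + 1), by positivity, ?_⟩
    rw [mul_div_assoc', div_lt_iff₀ (by positivity)]
    nlinarith [pow_pos hε₀ 2]
  -- The radius is that of the ball around `X k` which must contain the penalised minimum; there `w
  -- > S/2` and `|∇u| < ε₀` are incompatible.
  obtain ⟨k, hk⟩ := exists_forall_lt_of_tendsto_sup hwu hwC hwS hXS (by linarith : S / 2 < S) hsub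
    (√(2 * M / ε)) (S / 2) (by positivity)
  obtain ⟨x, hx1, hx2, -⟩ := exists_isLocalMin_add_mul_norm_sub_sq hu.contDiff hM (X k) hε
  have h1 := hk (x - X k) (Real.le_sqrt_of_sq_le (by rw [le_div_iff₀ hε]; linarith))
  rw [add_sub_cancel] at h1
  have h2 := hsmall (∇ u x) (lt_of_pow_lt_pow_left₀ 2 hε₀.le (hx2.trans_lt hεε))
  simp only [hw] at h1
  linarith

/-! ### Part 2: comparison of `u` with its translates -/

theorem laplacian_comp_add_right {u : RSpace n → ℝ} (hu : ContDiff ℝ 2 u) (h x : RSpace n) :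
    Δ (fun y => u (y + h)) x = Δ u (x + h) := by
  have h1 : fderiv ℝ (fun y => u (y + h)) = fun y => fderiv ℝ u (y + h) :=
    funext fun y => fderiv_comp_add_right h
  have hC : ContDiff ℝ 2 fun y => u (y + h) := hu.comp (contDiff_id.add contDiff_const)
  rw [laplacian_eq_sum_hessianMatrix hC.contDiffAt, laplacian_eq_sum_hessianMatrix hu.contDiffAt]
  simp only [hessianMatrix_apply hC.contDiffAt, hessianMatrix_apply hu.contDiffAt, h1]
  rw [fderiv_comp_add_right (f := fderiv ℝ u) h]

/-- Where `w = u(· + h) - u` is positive, monotonicity of `f` makes `w` subharmonic. A positive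
supremum would then force `w > S/2` along a chain of steps `h` too long for a bounded `u`. -/
theorem translate_le_of_laplacian_eq_monotone {u : RSpace n → ℝ} {f : ℝ → ℝ}
    (hu : StandingAssumption u) (hf : MonotoneOn f (Set.range u)) (hΔ : ∀ x, Δ u x = f (u x))
    (h x : RSpace n) : u (x + h) ≤ u x := by
  obtain ⟨M, hM⟩ := hu.bounded
  obtain ⟨B, hB, hgrad⟩ := hu.bounded_gradient
  by_contra! hlt
  have huu : UniformContinuous u := by
    refine (lipschitzWith_of_nnnorm_fderiv_le (C := ⟨B, hB.le⟩)
      (hu.contDiff.differentiable (by simp)) fun y => ?_).uniformContinuous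
    rw [← toDual_gradient, LinearIsometryEquiv.nnnorm_map]
    exact hgrad y
  set w : RSpace n → ℝ := fun y => u (y + h) - u y with hw
  have hT : ContDiff ℝ 2 fun y => u (y + h) := hu.contDiff.comp (contDiff_id.add contDiff_const)
  have hwC2 : ContDiff ℝ 2 w := hT.sub hu.contDiff
  have hwu : UniformContinuous w :=
    (huu.comp (uniformContinuous_id.add uniformContinuous_const)).sub huu
  have hwC : ∀ y, |w y| ≤ 2 * M := fun y => by
    have h1 := abs_le.1 (hM y)
    have h2 := abs_le.1 (hM (y + h))
    exact abs_le.2 ⟨by simp only [hw]; linarith, by simp only [hw]; linarith⟩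
  have hbdd : BddAbove (Set.range w) :=
    ⟨2 * M, by rintro _ ⟨y, rfl⟩; exact (abs_le.1 (hwC y)).2⟩
  set S := sSup (Set.range w) with hS
  have hwS : ∀ y, w y ≤ S := fun y => le_csSup hbdd ⟨y, rfl⟩
  have hS0 : 0 < S := lt_of_lt_of_le (sub_pos.2 hlt) (hwS x)
  obtain ⟨s, -, hsS, hsr⟩ := exists_seq_tendsto_sSup (Set.range_nonempty w) hbdd
  choose X hXs using hsr
  have hXS : Tendsto (fun k => w (X k)) atTop (𝓝 S) := by simpa only [hXs] using hsS
  have hsub : ∀ y, 0 < w y → ContDiffAt ℝ 2 w y ∧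
      ∃ A b, EllipticBounds 1 A b ∧ 0 ≤ pureOperator A b w y := fun y hy => by
    refine ⟨hwC2.contDiffAt, 1, 0, ellipticBounds_one_zero, ?_⟩
    have h1 : Δ w y = Δ (fun y => u (y + h)) y - Δ u y :=
      hT.contDiffAt.laplacian_sub hu.contDiff.contDiffAt
    rw [pureOperator_one_zero hwC2.contDiffAt, h1, laplacian_comp_add_right hu.contDiff, hΔ, hΔ,
      sub_nonneg]
    exact hf ⟨y, rfl⟩ ⟨y + h, rfl⟩ (sub_pos.1 hy).le
  -- `N` increments of `S/2` exceed the oscillation `2M`; the radius `N‖h‖` covers every starting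
  -- point `X k + j • h` with `j < N`.
  obtain ⟨N, hN⟩ := exists_nat_gt (2 * M / (S / 2))
  rw [div_lt_iff₀ (by positivity)] at hN
  obtain ⟨k, hk⟩ := exists_forall_lt_of_tendsto_sup hwu hwC hwS hXS hS0 hsub
    (N * ‖h‖) (S / 2) (by positivity)
  have hstep : ∀ j : ℕ, j ≤ N → u (X k) + j * (S / 2) ≤ u (X k + (j : ℝ) • h) := by
    intro j
    induction j with
    | zero => simp
    | succ j ih =>
      intro hj
      have h1 := ih (by omega)
      have h2 := hk ((j : ℝ) • h) (by
        rw [norm_smul, Real.norm_natCast]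
        gcongr
        omega)
      simp only [hw] at h2
      have h3 : X k + ((j + 1 : ℕ) : ℝ) • h = X k + (j : ℝ) • h + h := by
        push_cast
        rw [add_smul, one_smul, add_assoc]
      rw [h3]
      push_cast
      linarith
  have h1 := hstep N le_rfl
  have h2 := abs_le.1 (hM (X k))
  have h3 := abs_le.1 (hM (X k + (N : ℝ) • h))
  linarith

theorem exists_eq_const_of_laplacian_eq {f : ℝ → ℝ} {u : RSpace n → ℝ} (hf : Differentiable ℝ f)
    (hu : StandingAssumption u) (hΔ : ∀ x, Δ u x = f (u x)) (hf' : ∀ x, 0 ≤ deriv f (u x)) :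
    ∃ k : ℝ, ∀ x, u x = k := by
  -- The range of `u` is an interval, so the sign of `f'` on the values of `u` alone yields
  -- monotonicity there.
  have hconv : Convex ℝ (Set.range u) :=
    (isPreconnected_range hu.contDiff.continuous).ordConnected.convex
  have hmono : MonotoneOn f (Set.range u) :=
    monotoneOn_of_deriv_nonneg hconv hf.continuous.continuousOn hf.differentiableOn fun t ht => by
      obtain ⟨x, rfl⟩ := interior_subset ht
      exact hf' x
  have hle := translate_le_of_laplacian_eq_monotone hu hmono hΔ
  refine ⟨u 0, fun x => le_antisymm ?_ ?_⟩
  · simpa using hle x 0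
  · simpa using hle (-x) x

end

theorem mainTheorem7 (n : ℕ) :
    (∀ (F : ℝ × RSpace n × Matrix (Fin n) (Fin n) ℝ → ℝ) (u : RSpace n → ℝ)
        (g : RSpace n → ℝ) (μ : ℝ → ℝ),
      Continuous F → IsEntireSolution F u → StandingAssumption u →
      Continuous g → (∀ p, 0 ≤ g p) → {p | g p = 0} = {0} →
      (∀ t : ℝ, 0 < t → 0 < μ t) →
      IsPFunction u (fun _ p => g p) (fun x => μ ‖∇ u x‖) →
      ∃ k : ℝ, ∀ x, u x = k) ∧
    (∀ (f : ℝ → ℝ) (u : RSpace n → ℝ),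
      Differentiable ℝ f → StandingAssumption u →
      (∀ x, Δ u x = f (u x)) → (∀ x, 0 ≤ deriv f (u x)) →
      ∃ k : ℝ, ∀ x, u x = k) ∧
    (∀ G : ℝ → ℝ, Continuous G → G 0 ≠ 0 →
      ¬ ∃ u : RSpace n → ℝ, StandingAssumption u ∧ ∀ x, Δ u x = G (‖∇ u x‖ ^ 2)) :=
  ⟨fun _ _ _ _ _ _ hu hg hg0 hgz hμ hP => exists_eq_const_of_isPFunction hu hg hg0 hgz hμ hP,
    fun _ _ hf hu hΔ hf' => exists_eq_const_of_laplacian_eq hf hu hΔ hf',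
    fun _ hG hG0 => not_exists_laplacian_eq_comp_gradient hG hG0⟩
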